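/- All spaces are real. For a bounded linear operator $T:X\to Y$ between Banach spaces let $M_T=\{x\in X:\|x\|=1,\ \|Tx\|=\|T\|\}$ denote its norm attainment set. Let $\|T\|=1$ and $\varepsilon>0$. An operator $A:X\to Y$ with $\|A\|=1$ is called a uniform $\varepsilon$-BPB approximation of $T$ if there is $\delta>0$ such that for every $x_0\in X$ with $\|x_0\|=1$ and $\|Tx_0\|>1-\delta$ there is $u_0\in M_A$ with $\|u_0-x_0\|<\varepsilon$ and $\|T-A\|<\varepsilon$; it is called non-trivial if moreover $A\neq T$. The pair $(X,Y)$ has the non-trivial norm preserving uniform BPB approximation property if for every bounded linear $T:X\to Y$ with $\|T\|=1$ that is not an isometry and for every $\varepsilon>0$ there is a non-trivial uniform $\varepsilon$-BPB approximation $A_\varepsilon$ of $T$ with $M_{A_\varepsilon}=M_T$. An extreme contraction is an extreme point of the closed unit ball of the space of bounded linear operators $X\to Y$ with the operator norm. (a) Let $T:\ell_\infty^3\to\ell_1^3$ be an extreme contraction. Then for each $\varepsilon>0$, $T$ admits a non-trivial uniform $\varepsilon$-BPB approximation $A_\varepsilon$ with $M_{A_\varepsilon}=M_T$. (b) The pair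 $(\ell_\infty^3,\ell_1^3)$ has the non-trivial norm preserving uniform BPB approximation property. -/

import Mathlib

open scoped ENNReal

namespace UniformBPB

/-- The space `ℝⁿ` with the `ℓ_p` norm. -/
abbrev ell (p : ℝ≥0∞) (n : ℕ) : Type := PiLp p (fun _ : Fin n => ℝ)

section

variable {X Y : Type*} [NormedAddCommGroup X] [NormedSpace ℝ X]
  [NormedAddCommGroup Y] [NormedSpace ℝ Y]

/-- The norm attainment set `M_T = {x ∈ S_X : ‖T x‖ = ‖T‖}`. -/
def normAttainmentSet (T : X →L[ℝ] Y) : Set X :=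
  {x | ‖x‖ = 1 ∧ ‖T x‖ = ‖T‖}

/-- `T` is an extreme point of the closed unit ball of the space of bounded operators. -/
def IsExtremeContraction (T : X →L[ℝ] Y) : Prop :=
  T ∈ Set.extremePoints ℝ (Metric.closedBall (0 : X →L[ℝ] Y) 1)

/-- The norm one operator `A` is a uniform `ε`-BPB approximation of the norm one operator `T`. -/
def IsUniformBPBApprox (ε : ℝ) (T A : X →L[ℝ] Y) : Prop :=
  ‖T‖ = 1 ∧ ‖A‖ = 1 ∧
    ∃ δ : ℝ, 0 < δ ∧ ∀ x₀ : X, ‖x₀‖ = 1 → 1 - δ < ‖T x₀‖ →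
      ∃ u₀ ∈ normAttainmentSet A, ‖u₀ - x₀‖ < ε ∧ ‖T - A‖ < ε

/-- A uniform `ε`-BPB approximation of `T` which is different from `T`. -/
def IsNontrivialUniformBPBApprox (ε : ℝ) (T A : X →L[ℝ] Y) : Prop :=
  IsUniformBPBApprox ε T A ∧ A ≠ T

end

/-- The pair `(X, Y)` has the non-trivial norm preserving uniform BPB approximation property:
every norm one operator which is not an isometry has, for every `ε > 0`, a non-trivial uniform
`ε`-BPB approximation with the same norm attainment set. -/
def HasNontrivialNormPreservingUniformBPB (X Y : Type*)
    [NormedAddCommGroup X] [NormedSpace ℝ X] [NormedAddCommGroup Y] [NormedSpace ℝ Y] : Prop :=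
  ∀ T : X →L[ℝ] Y, ‖T‖ = 1 → ¬ Isometry T → ∀ ε : ℝ, 0 < ε →
    ∃ A : X →L[ℝ] Y, IsNontrivialUniformBPBApprox ε T A ∧
      normAttainmentSet T = normAttainmentSet A

end UniformBPB

/-!
In finite dimension, compactness of the sphere reduces the theorem to finding, arbitrarily close
to `T`, an operator `A ≠ T` of norm one with the same norm attainment set. If `T` is not an extreme
contraction, then `‖T ± D‖ ≤ 1` for some `D ≠ 0`, and `A = T + t • D` works for every small
`t > 0`. If some coordinate of `T` vanishes, a fraction of another coordinate can be moved there
without changing any of the norms `‖T x‖`.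

It remains to see that an extreme contraction `T : ℓ_∞³ → ℓ_1ⁿ`, where `n ≥ 3`, has a vanishing
coordinate. Up to sign the cube has four vertices `v₀, …, v₃`, chosen with sum zero. If
`‖T vₚ‖ < 1`, the other three `T vⱼ` must be extreme points `±eᵢ` of the unit ball, so the
coordinates of `T vₚ = -∑ T vⱼ` add up to an odd integer, which is absurd. Hence `‖T vⱼ‖ = 1` for
all `j`. Splitting every coordinate of `(T vⱼ)` into transports from its positive to its negative
entries gives weights on the edges of `K₄` whose sum at each vertex is one, and the two edges of
each of the three perfect matchings then have equal weights. So `T` is a convex combination of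
three operators `(x_a + x_b) / 2 • u + (x_a - x_b) / 2 • w` with `‖u‖ = ‖w‖ = 1`, and by
extremality it is one of them, with `u = ±eᵢ` and `w = ±eₖ`.
-/

namespace UniformBPB

section ExtremePoints

theorem mem_extremePoints_iff_forall_add_sub {E : Type*} [AddCommGroup E] [Module ℝ E]
    {s : Set E} (hs : Convex ℝ s) {x : E} :
    x ∈ s.extremePoints ℝ ↔ x ∈ s ∧ ∀ d, x + d ∈ s → x - d ∈ s → d = 0 := by
  rw [mem_extremePoints_iff_left]
  refine and_congr_right fun hx => ⟨fun h d hadd hsub => ?_, fun h y hy z hz hyz => ?_⟩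
  · have hmid : x ∈ openSegment ℝ (x + d) (x - d) :=
      ⟨1 / 2, 1 / 2, by norm_num, by norm_num, by norm_num, by module⟩
    exact add_eq_left.1 (h _ hadd _ hsub hmid)
  · obtain ⟨a, b, ha, hb, hab, rfl⟩ := hyz
    obtain rfl : b = 1 - a := by linarith
    have hd : (a * (1 - a)) • (y - z) = 0 := by
      refine h _ ?_ ?_
      · convert hs hx hy hb.le ha.le (by ring) using 1
        module
      · convert hs hx hz ha.le hb.le (by ring) using 1
        module
    obtain rfl : y = z := sub_eq_zero.1 ((smul_eq_zero.1 hd).resolve_left (by positivity))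
    module

variable {E : Type*} [NormedAddCommGroup E] [NormedSpace ℝ E]

theorem mem_extremePoints_closedBall_iff {x : E} :
    x ∈ (Metric.closedBall (0 : E) 1).extremePoints ℝ ↔
      ‖x‖ ≤ 1 ∧ ∀ d, ‖x + d‖ ≤ 1 → ‖x - d‖ ≤ 1 → d = 0 := by
  simp only [mem_extremePoints_iff_forall_add_sub (convex_closedBall (0 : E) 1),
    mem_closedBall_zero_iff]

theorem norm_add_smul_le_of_norm_add_le {y d : E} {r t : ℝ} (hy : ‖y‖ ≤ r) (hd : ‖y + d‖ ≤ r)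
    (ht : t ∈ Set.Icc (0 : ℝ) 1) : ‖y + t • d‖ ≤ r := by
  have hconv := convex_closedBall (0 : E) r (mem_closedBall_zero_iff.2 hy)
    (mem_closedBall_zero_iff.2 hd) (sub_nonneg.2 ht.2) ht.1 (sub_add_cancel _ _)
  rwa [mem_closedBall_zero_iff, show (1 - t) • y + t • (y + d) = y + t • d by module] at hconv

theorem norm_add_smul_eq_one_iff {y d : E} (hadd : ‖y + d‖ ≤ 1) (hsub : ‖y - d‖ ≤ 1) {t : ℝ}
    (ht : t ∈ Set.Ioo (0 : ℝ) 1) : ‖y + t • d‖ = 1 ↔ ‖y‖ = 1 := by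
  obtain ⟨ht0, ht1⟩ := ht
  have hy : ‖y‖ ≤ 1 := by
    have : (2 : ℝ) * ‖y‖ ≤ 2 := by
      calc (2 : ℝ) * ‖y‖ = ‖(y + d) + (y - d)‖ := by
            rw [add_add_sub_cancel, ← two_smul ℝ, norm_smul, Real.norm_ofNat]
        _ ≤ 2 := by grw [norm_add_le, hadd, hsub]; norm_num
    linarith
  constructor <;> intro h
  · have : ‖y + t • d‖ ≤ (1 - t) * ‖y‖ + t * ‖y + d‖ := by
      calc ‖y + t • d‖ = ‖(1 - t) • y + t • (y + d)‖ := by congr 1; module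
        _ ≤ _ := by
          grw [norm_add_le, norm_smul, norm_smul, Real.norm_of_nonneg ht0.le,
            Real.norm_of_nonneg (sub_nonneg.2 ht1.le)]
    nlinarith
  · refine (norm_add_smul_le_of_norm_add_le hy hadd ⟨ht0.le, ht1.le⟩).antisymm ?_
    have : (1 + t) * ‖y‖ ≤ ‖y + t • d‖ + t * ‖y - d‖ := by
      calc (1 + t) * ‖y‖ = ‖(y + t • d) + t • (y - d)‖ := by
            rw [show (y + t • d) + t • (y - d) = (1 + t) • y by module, norm_smul,
              Real.norm_of_nonneg (by positivity)]
        _ ≤ _ := by grw [norm_add_le, norm_smul, Real.norm_of_nonneg ht0.le]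
    nlinarith

theorem eq_smul_of_sum_eq_of_mem_extremePoints {κ : Type*} {s : Finset κ} {x : E}
    (hx : x ∈ (Metric.closedBall (0 : E) 1).extremePoints ℝ) {a : κ → E} {c : κ → ℝ}
    (ha : ∀ k ∈ s, ‖a k‖ ≤ c k) (hc : ∑ k ∈ s, c k ≤ 1) (hsum : ∑ k ∈ s, a k = x)
    {k : κ} (hk : k ∈ s) : a k = c k • x := by
  classical
  obtain ⟨hx1, hx⟩ := mem_extremePoints_closedBall_iff.1 hx
  have hck : 0 ≤ c k := (norm_nonneg _).trans (ha k hk)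
  have hrest : ‖x - a k‖ ≤ 1 - c k := by
    rw [← hsum, ← Finset.sum_erase_eq_sub hk]
    refine (norm_sum_le_of_le _ fun i hi => ha i (Finset.mem_of_mem_erase hi)).trans ?_
    rw [Finset.sum_erase_eq_sub hk]
    linarith
  refine sub_eq_zero.1 (hx _ ?_ ?_)
  · calc ‖x + (a k - c k • x)‖ = ‖(1 - c k) • x + a k‖ := by congr 1; module
      _ ≤ (1 - c k) * ‖x‖ + ‖a k‖ := by
        grw [norm_add_le, norm_smul,
          Real.norm_of_nonneg (le_trans (norm_nonneg _) hrest)]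
      _ ≤ (1 - c k) * 1 + c k := by
        have := (norm_nonneg _).trans hrest
        gcongr
        exact ha k hk
      _ = 1 := by ring
  · calc ‖x - (a k - c k • x)‖ = ‖(x - a k) + c k • x‖ := by congr 1; module
      _ ≤ ‖x - a k‖ + c k * ‖x‖ := by grw [norm_add_le, norm_smul, Real.norm_of_nonneg hck]
      _ ≤ (1 - c k) + c k * 1 := by gcongr
      _ = 1 := by ring

theorem exists_eq_single_of_mem_extremePoints {ι : Type*} [Fintype ι] [DecidableEq ι] [Nonempty ι]
    {u : PiLp 1 fun _ : ι => ℝ}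
    (hu : u ∈ (Metric.closedBall (0 : PiLp 1 fun _ : ι => ℝ) 1).extremePoints ℝ) :
    ∃ i c, |c| = 1 ∧ u = PiLp.single 1 i c := by
  have hu1 : ‖u‖ = 1 := by simpa using extremePoints_closedBall_subset_sphere hu
  obtain ⟨i, hi⟩ : ∃ i, u i ≠ 0 := by
    by_contra! h
    have : u = 0 := by ext i; exact h i
    simp [this] at hu1
  have hsingle : PiLp.single 1 i (u i) = |u i| • u := by
    refine eq_smul_of_sum_eq_of_mem_extremePoints hu (s := Finset.univ)
      (a := fun k => PiLp.single 1 k (u k)) (c := fun k => |u k|) (by simp) ?_ ?_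
      (Finset.mem_univ i)
    · rw [← hu1, PiLp.norm_eq_of_L1]
      simp
    · ext k
      simp [Finset.sum_apply, Pi.single_apply]
  refine ⟨i, |u i|⁻¹ * u i, ?_, ?_⟩
  · rw [abs_mul, abs_inv, abs_abs, inv_mul_cancel₀ (abs_ne_zero.2 hi)]
  · calc u = |u i|⁻¹ • PiLp.single 1 i (u i) := by
          rw [hsingle, inv_smul_smul₀ (abs_ne_zero.2 hi)]
      _ = PiLp.single 1 i (|u i|⁻¹ * u i) := by ext k; simp

theorem norm_add_smul_single_sub_single {ι : Type*} [Fintype ι] [DecidableEq ι]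
    {y : PiLp 1 fun _ : ι => ℝ} {j k : ι} (hjk : j ≠ k) (hk : y k = 0) {t : ℝ}
    (ht : t ∈ Set.Icc (0 : ℝ) 1) :
    ‖y + t • y j • (PiLp.single 1 k 1 - PiLp.single 1 j 1 : PiLp 1 fun _ : ι => ℝ)‖ = ‖y‖ := by
  have hterm (i : ι) :
      ‖(y + t • y j • (PiLp.single 1 k 1 - PiLp.single 1 j 1 : PiLp 1 fun _ : ι => ℝ)) i‖ =
        ‖y i‖ + ((if i = k then t * |y j| else 0) - if i = j then t * |y j| else 0) := by
    by_cases hik : i = k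
    · subst hik
      simp [hjk.symm, hk, abs_of_nonneg ht.1]
    by_cases hij : i = j
    · subst hij
      simp only [PiLp.add_apply, PiLp.smul_apply, PiLp.sub_apply, PiLp.single_apply, hik,
        ↓reduceIte, smul_eq_mul, Real.norm_eq_abs]
      rw [show y i + t * (y i * (0 - 1)) = (1 - t) * y i by ring, abs_mul,
        abs_of_nonneg (sub_nonneg.2 ht.2)]
      ring
    · simp [hik, hij]
  simp only [PiLp.norm_eq_of_L1, hterm]
  simp [Finset.sum_add_distrib]

end ExtremePoints

section Approximation

variable {X Y : Type*} [NormedAddCommGroup X] [NormedSpace ℝ X] [FiniteDimensional ℝ X]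
  [NormedAddCommGroup Y] [NormedSpace ℝ Y]

theorem exists_pos_forall_exists_normAttainmentSet_near (T : X →L[ℝ] Y) {ε : ℝ} (hε : 0 < ε) :
    ∃ δ : ℝ, 0 < δ ∧ ∀ x, ‖x‖ = 1 → ‖T‖ - δ < ‖T x‖ →
      ∃ u ∈ normAttainmentSet T, ‖u - x‖ < ε := by
  set K : Set X := Metric.sphere 0 1 \ Metric.thickening ε (normAttainmentSet T)
  have hK : IsCompact K := (isCompact_sphere 0 1).diff Metric.isOpen_thickening
  have hgap : ∀ x ∈ K, 0 < ‖T‖ - ‖T x‖ := by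
    rintro x ⟨hx, hxT⟩
    rw [mem_sphere_zero_iff_norm] at hx
    have hle : ‖T x‖ ≤ ‖T‖ := T.unit_le_opNorm x hx.le
    refine sub_pos.2 (hle.lt_of_ne fun h => hxT ?_)
    exact Metric.self_subset_thickening hε _ ⟨hx, h⟩
  obtain ⟨δ, hδ, hδK⟩ := hK.exists_forall_le' (by fun_prop) hgap
  refine ⟨δ, hδ, fun x hx hTx => ?_⟩
  have hxK : x ∉ K := fun h => by linarith [hδK x h]
  have hxT : x ∈ Metric.thickening ε (normAttainmentSet T) := by
    by_contra h
    exact hxK ⟨by simpa using hx, h⟩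
  simpa only [Metric.mem_thickening_iff, dist_comm x, dist_eq_norm] using hxT

theorem isUniformBPBApprox_of_normAttainmentSet_eq {ε : ℝ} (hε : 0 < ε) {T A : X →L[ℝ] Y}
    (hT : ‖T‖ = 1) (hA : ‖A‖ = 1) (hM : normAttainmentSet T = normAttainmentSet A)
    (hTA : ‖T - A‖ < ε) : IsUniformBPBApprox ε T A := by
  obtain ⟨δ, hδ, h⟩ := exists_pos_forall_exists_normAttainmentSet_near T hε
  refine ⟨hT, hA, δ, hδ, fun x hx hTx => ?_⟩
  obtain ⟨u, hu, hux⟩ := h x hx (by rwa [hT])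
  exact ⟨u, hM ▸ hu, hux, hTA⟩

theorem exists_nontrivial_approx_of_forall_add_smul {T D : X →L[ℝ] Y} (hT : ‖T‖ = 1) (hD : D ≠ 0)
    (h : ∀ t ∈ Set.Ioo (0 : ℝ) 1,
      ‖T + t • D‖ = 1 ∧ normAttainmentSet T = normAttainmentSet (T + t • D))
    {ε : ℝ} (hε : 0 < ε) :
    ∃ A : X →L[ℝ] Y, IsNontrivialUniformBPBApprox ε T A ∧
      normAttainmentSet T = normAttainmentSet A := by
  have hD' : 0 < ‖D‖ := norm_pos_iff.2 hD
  obtain ⟨t, ht0, ht⟩ := exists_between (lt_min one_pos (div_pos hε hD'))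
  obtain ⟨ht1, htε⟩ := lt_min_iff.1 ht
  obtain ⟨hA, hM⟩ := h t ⟨ht0, ht1⟩
  refine ⟨T + t • D, ⟨isUniformBPBApprox_of_normAttainmentSet_eq hε hT hA hM ?_, ?_⟩, hM⟩
  · rw [sub_add_cancel_left, norm_neg, norm_smul, Real.norm_of_nonneg ht0.le]
    exact (lt_div_iff₀ hD').1 htε
  · simp [hD, ht0.ne']

theorem exists_nontrivial_approx_of_not_isExtremeContraction {T : X →L[ℝ] Y} (hT : ‖T‖ = 1)
    (hext : ¬ IsExtremeContraction T) {ε : ℝ} (hε : 0 < ε) :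
    ∃ A : X →L[ℝ] Y, IsNontrivialUniformBPBApprox ε T A ∧
      normAttainmentSet T = normAttainmentSet A := by
  rw [IsExtremeContraction, mem_extremePoints_closedBall_iff] at hext
  push Not at hext
  obtain ⟨D, hadd, hsub, hD⟩ := hext hT.le
  refine exists_nontrivial_approx_of_forall_add_smul hT hD (fun t ht => ?_) hε
  have hA : ‖T + t • D‖ = 1 := (norm_add_smul_eq_one_iff hadd hsub ht).2 hT
  refine ⟨hA, Set.ext fun x => and_congr_right fun hx => ?_⟩
  have hle {S : X →L[ℝ] Y} (hS : ‖S‖ ≤ 1) : ‖S x‖ ≤ 1 := (S.unit_le_opNorm x hx.le).trans hS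
  rw [hT, hA]
  exact (norm_add_smul_eq_one_iff (hle hadd) (hle hsub) ht).symm

theorem exists_nontrivial_approx_of_coord_eq_zero {ι : Type*} [Fintype ι]
    {T : X →L[ℝ] PiLp 1 fun _ : ι => ℝ} (hT : ‖T‖ = 1) {k : ι} (hk : ∀ x, T x k = 0)
    {ε : ℝ} (hε : 0 < ε) :
    ∃ A : X →L[ℝ] PiLp 1 fun _ : ι => ℝ, IsNontrivialUniformBPBApprox ε T A ∧
      normAttainmentSet T = normAttainmentSet A := by
  classical
  obtain ⟨z, j, hj⟩ : ∃ z j, T z j ≠ 0 := by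
    by_contra! h
    have : T = 0 := by ext x i; exact h x i
    simp [this] at hT
  have hjk : j ≠ k := by rintro rfl; exact hj (hk z)
  set D : X →L[ℝ] PiLp 1 fun _ : ι => ℝ :=
    ((PiLp.proj 1 (fun _ : ι => ℝ) j).comp T).smulRight (PiLp.single 1 k 1 - PiLp.single 1 j 1)
  have hD : D ≠ 0 := fun h => hj <| by
    simpa [D, hjk.symm] using congr(($h z).ofLp k)
  refine exists_nontrivial_approx_of_forall_add_smul hT hD (fun t ht => ?_) hε
  have hnorm (x : X) : ‖(T + t • D) x‖ = ‖T x‖ :=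
    norm_add_smul_single_sub_single hjk (hk x) ⟨ht.1.le, ht.2.le⟩
  have hA : ‖T + t • D‖ = ‖T‖ := ContinuousLinearMap.opNorm_ext _ _ hnorm
  exact ⟨hA.trans hT, by simp only [normAttainmentSet, hnorm, hA]⟩

end Approximation

section Cube

/-- Representatives, up to sign, of the vertices of the cube, chosen with sum zero. -/
def cubeVertex (j : Fin 4) : ell ∞ 3 :=
  WithLp.toLp ∞ (![![1, 1, 1], ![1, -1, -1], ![-1, 1, -1], ![-1, -1, 1]] j)

theorem norm_cubeVertex_le (j : Fin 4) : ‖cubeVertex j‖ ≤ 1 := by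
  rw [cubeVertex, PiLp.norm_toLp, pi_norm_le_iff_of_nonneg zero_le_one]
  intro i
  fin_cases j <;> fin_cases i <;> simp

theorem sum_cubeVertex : ∑ j, cubeVertex j = 0 := by
  ext i
  fin_cases i <;> simp [Fin.sum_univ_four, cubeVertex]

theorem sum_cubeVertex_mul_cubeVertex (j k : Fin 4) :
    ∑ i, cubeVertex j i * cubeVertex k i = if j = k then 3 else -1 := by
  fin_cases j <;> fin_cases k <;> simp [Fin.sum_univ_three, cubeVertex] <;> norm_num

theorem abs_add_add_add_mul_le {a b c : ℝ} (ha : |a| ≤ 1) (hb : |b| ≤ 1) (hc : |c| ≤ 1) :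
    |a + b + c + a * b * c| ≤ 1 + a * b + a * c + b * c := by
  rw [abs_le] at *
  have hpos : 0 ≤ (1 + a) * (1 + b) * (1 + c) :=
    mul_nonneg (mul_nonneg (by linarith) (by linarith)) (by linarith)
  have hneg : 0 ≤ (1 - a) * (1 - b) * (1 - c) :=
    mul_nonneg (mul_nonneg (by linarith) (by linarith)) (by linarith)
  constructor <;> linarith

theorem exists_eq_sum_smul_cubeVertex {x : ell ∞ 3} (hx : ‖x‖ ≤ 1) :
    ∃ l : Fin 4 → ℝ, ∑ j, |l j| ≤ 1 ∧ x = ∑ j, l j • cubeVertex j := by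
  have hi (i : Fin 3) : |x i| ≤ 1 := (PiLp.norm_apply_le x i).trans hx
  have hi' (i : Fin 3) : |-x i| ≤ 1 := (abs_neg (x i)).trans_le (hi i)
  have h0 := abs_add_add_add_mul_le (hi 0) (hi 1) (hi 2)
  have h1 := abs_add_add_add_mul_le (hi 0) (hi' 1) (hi' 2)
  have h2 := abs_add_add_add_mul_le (hi' 0) (hi 1) (hi' 2)
  have h3 := abs_add_add_add_mul_le (hi' 0) (hi' 1) (hi 2)
  -- Each vertex `v` of the cube has the product weight `∏ i, (1 + v i * x i) / 2`; the coefficient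
  -- of a representative `v` is the weight of `v` minus that of `-v`.
  refine ⟨![(x 0 + x 1 + x 2 + x 0 * x 1 * x 2) / 4,
    (x 0 + -x 1 + -x 2 + x 0 * -x 1 * -x 2) / 4, (-x 0 + x 1 + -x 2 + -x 0 * x 1 * -x 2) / 4,
    (-x 0 + -x 1 + x 2 + -x 0 * -x 1 * x 2) / 4], ?_, ?_⟩
  · simp only [Fin.sum_univ_four, Matrix.cons_val, abs_div, abs_of_pos (zero_lt_four' ℝ)]
    linarith
  · ext i
    fin_cases i <;> simp [Fin.sum_univ_four, cubeVertex] <;> ring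

variable {Y : Type*} [NormedAddCommGroup Y] [NormedSpace ℝ Y]

theorem opNorm_le_of_norm_apply_cubeVertex_le {T : ell ∞ 3 →L[ℝ] Y} {C : ℝ}
    (h : ∀ j, ‖T (cubeVertex j)‖ ≤ C) : ‖T‖ ≤ C := by
  have hC : 0 ≤ C := (norm_nonneg _).trans (h 0)
  refine T.opNorm_le_of_unit_norm hC fun x hx => ?_
  obtain ⟨l, hl, hxl⟩ := exists_eq_sum_smul_cubeVertex hx.le
  calc ‖T x‖ = ‖∑ j, l j • T (cubeVertex j)‖ := by rw [hxl]; simp only [map_sum, map_smul]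
    _ ≤ ∑ j, |l j| * C := norm_sum_le_of_le _ fun j _ => by
      rw [norm_smul, Real.norm_eq_abs]
      gcongr
      exact h j
    _ ≤ C := by rw [← Finset.sum_mul]; exact mul_le_of_le_one_left hC hl

theorem ext_cubeVertex {S T : ell ∞ 3 →L[ℝ] Y} (h : ∀ j, S (cubeVertex j) = T (cubeVertex j)) :
    S = T := by
  rw [← sub_eq_zero, ← norm_le_zero_iff]
  exact opNorm_le_of_norm_apply_cubeVertex_le fun j => by simp [h j]

theorem exists_apply_cubeVertex_eq {y : Fin 4 → Y} (hy : ∑ j, y j = 0) :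
    ∃ B : ell ∞ 3 →L[ℝ] Y, ∀ j, B (cubeVertex j) = y j := by
  refine ⟨∑ j, ((1 / 4 : ℝ) • ∑ i, cubeVertex j i • PiLp.proj ∞ (fun _ => ℝ) i).smulRight (y j),
    fun k => ?_⟩
  have hcoeff (j : Fin 4) : (1 / 4 : ℝ) * ∑ i, cubeVertex j i * cubeVertex k i =
      (if j = k then 1 else 0) - 1 / 4 := by
    rw [sum_cubeVertex_mul_cubeVertex]
    split_ifs <;> norm_num
  calc _ = ∑ j, ((1 / 4 : ℝ) * ∑ i, cubeVertex j i * cubeVertex k i) • y j := by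
        simp
    _ = y k := by
        simp only [hcoeff, sub_smul, Finset.sum_sub_distrib, ← Finset.smul_sum, hy]
        simp

theorem norm_add_le_one_of_apply_cubeVertex_eq {T B : ell ∞ 3 →L[ℝ] Y} (hT : ‖T‖ ≤ 1)
    {j p : Fin 4} (hjp : j ≠ p) {e : Y} (hj : ‖T (cubeVertex j) + e‖ ≤ 1)
    (hp : ‖T (cubeVertex p)‖ + ‖e‖ ≤ 1)
    (hB : ∀ k, B (cubeVertex k) = (Pi.single j e - Pi.single p e : Fin 4 → Y) k) :
    ‖T + B‖ ≤ 1 := by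
  refine opNorm_le_of_norm_apply_cubeVertex_le fun k => ?_
  rw [add_apply, hB]
  rcases eq_or_ne k j with rfl | hkj
  · simpa [hjp] using hj
  rcases eq_or_ne k p with rfl | hkp
  · simpa [hkj, ← sub_eq_add_neg] using (norm_sub_le _ _).trans hp
  · simpa [hkj, hkp] using T.unit_le_opNorm _ (norm_cubeVertex_le k) |>.trans hT

theorem apply_cubeVertex_mem_extremePoints {T : ell ∞ 3 →L[ℝ] Y} (hT : IsExtremeContraction T)
    {j p : Fin 4} (hjp : j ≠ p) (hp : ‖T (cubeVertex p)‖ < 1) :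
    T (cubeVertex j) ∈ (Metric.closedBall (0 : Y) 1).extremePoints ℝ := by
  obtain ⟨hT1, hT⟩ := mem_extremePoints_closedBall_iff.1 hT
  have hTj : ‖T (cubeVertex j)‖ ≤ 1 := (T.unit_le_opNorm _ (norm_cubeVertex_le j)).trans hT1
  refine mem_extremePoints_closedBall_iff.2 ⟨hTj, fun d hadd hsub => ?_⟩
  obtain ⟨c, hc, hcd⟩ := exists_pos_mul_lt (sub_pos.2 hp) ‖d‖
  set r := min c 1
  have hr0 : 0 < r := lt_min hc one_pos
  have hr : r ∈ Set.Icc (0 : ℝ) 1 := ⟨hr0.le, min_le_right c 1⟩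
  have hrd : ‖T (cubeVertex p)‖ + ‖r • d‖ ≤ 1 := by
    have : ‖d‖ * r ≤ ‖d‖ * c := by gcongr; exact min_le_left c 1
    rw [norm_smul, Real.norm_of_nonneg hr.1]
    linarith
  obtain ⟨B, hB⟩ := exists_apply_cubeVertex_eq
    (y := (Pi.single j (r • d) - Pi.single p (r • d) : Fin 4 → Y)) (by simp)
  have hB0 : B = 0 := by
    refine hT B ?_ ?_
    · exact norm_add_le_one_of_apply_cubeVertex_eq hT1 hjp
        (norm_add_smul_le_of_norm_add_le hTj hadd hr) hrd hB
    · rw [sub_eq_add_neg] at hsub ⊢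
      refine norm_add_le_one_of_apply_cubeVertex_eq hT1 hjp
        (norm_add_smul_le_of_norm_add_le hTj hsub hr) (by simpa using hrd) fun k => ?_
      simp [hB, Pi.single_neg]
      abel
  have hrd0 : r • d = 0 := by simpa [hB0, hjp] using (hB j).symm
  exact (smul_eq_zero.1 hrd0).resolve_left hr0.ne'

theorem norm_apply_cubeVertex_eq_one {ι : Type*} [Fintype ι] [Nonempty ι]
    {T : ell ∞ 3 →L[ℝ] PiLp 1 fun _ : ι => ℝ} (hT : IsExtremeContraction T) (p : Fin 4) :
    ‖T (cubeVertex p)‖ = 1 := by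
  classical
  have hT1 : ‖T‖ ≤ 1 := (mem_extremePoints_closedBall_iff.1 hT).1
  refine ((T.unit_le_opNorm _ (norm_cubeVertex_le p)).trans hT1).antisymm ?_
  by_contra! hp
  set σ : Fin 4 → ℝ := fun j => ∑ i, T (cubeVertex j) i
  have hsum : ∑ j, σ j = 0 := by
    have hy : ∑ j, T (cubeVertex j) = 0 := by rw [← map_sum, sum_cubeVertex, map_zero]
    rw [Finset.sum_comm]
    exact Finset.sum_eq_zero fun i _ => by simpa using congr(($hy).ofLp i)
  have hσp : |σ p| < 1 := by
    refine (Finset.abs_sum_le_sum_abs _ _).trans_lt ?_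
    simpa only [PiLp.norm_eq_of_L1, Real.norm_eq_abs] using hp
  have hσ (j : Fin 3) : σ (p.succAbove j) = 1 ∨ σ (p.succAbove j) = -1 := by
    obtain ⟨i, c, hc, hi⟩ := exists_eq_single_of_mem_extremePoints
      (apply_cubeVertex_mem_extremePoints hT (p.succAbove_ne j) hp)
    rw [← abs_eq zero_le_one, show σ (p.succAbove j) = c by simp [σ, hi], hc]
  rw [Fin.sum_univ_succAbove σ p, Fin.sum_univ_three] at hsum
  obtain ⟨hlo, hhi⟩ := abs_lt.1 hσp
  rcases hσ 0 with h0 | h0 <;> rcases hσ 1 with h1 | h1 <;> rcases hσ 2 with h2 | h2 <;> linarith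

end Cube

section Transport

theorem abs_mul_abs_sub_mul_abs (a b : ℝ) : |a * |b| - b * (|a|)| = |a| * |b| - a * b := by
  rcases le_total 0 a with ha | ha <;> rcases le_total 0 b with hb | hb <;>
    simp only [abs_of_nonneg, abs_of_nonpos, ha, hb]
  · simp [mul_comm]
  · rw [abs_of_nonneg (by nlinarith)]; ring
  · rw [abs_of_nonpos (by nlinarith)]; ring
  · simp [mul_comm]

theorem exists_antisymm_sum_eq {κ : Type*} [Fintype κ] {r : κ → ℝ} (hr : ∑ k, r k = 0) :
    ∃ s : κ → κ → ℝ, (∀ j k, s k j = -s j k) ∧ ∀ j, ∑ k, s j k = r j ∧ ∑ k, |s j k| = |r j| := by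
  set R := ∑ k, |r k|
  have hR : 0 ≤ R := Finset.sum_nonneg fun k _ => abs_nonneg _
  have hdiv (j : κ) : r j * R / R = r j ∧ |r j| * R / R = |r j| := by
    rcases hR.eq_or_lt with h | h
    · have : |r j| = 0 := (Finset.sum_eq_zero_iff_of_nonneg fun k _ => abs_nonneg (r k)).1 h.symm j
        (Finset.mem_univ j)
      simp [abs_eq_zero.1 this]
    · exact ⟨mul_div_cancel_right₀ _ h.ne', mul_div_cancel_right₀ _ h.ne'⟩
  -- Proportional transport: `r j * |r k| - r k * |r j| = 2 * ((r j)⁺ * (r k)⁻ - (r k)⁺ * (r j)⁻)`.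
  refine ⟨fun j k => (r j * |r k| - r k * |r j|) / R, fun j k => by ring, fun j => ⟨?_, ?_⟩⟩
  · rw [← Finset.sum_div, Finset.sum_sub_distrib, ← Finset.mul_sum, ← Finset.sum_mul, hr, zero_mul,
      sub_zero, (hdiv j).1]
  · simp only [abs_div, abs_of_nonneg hR, abs_mul_abs_sub_mul_abs]
    rw [← Finset.sum_div, Finset.sum_sub_distrib, ← Finset.mul_sum, ← Finset.mul_sum, hr, mul_zero,
      sub_zero, (hdiv j).2]

theorem exists_antisymm_sum_eq_piLp {κ ι : Type*} [Fintype κ] [Fintype ι]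
    {y : κ → PiLp 1 fun _ : ι => ℝ} (hy : ∑ k, y k = 0) :
    ∃ s : κ → κ → PiLp 1 fun _ : ι => ℝ,
      (∀ j k, s k j = -s j k) ∧ ∀ j, ∑ k, s j k = y j ∧ ∑ k, ‖s j k‖ = ‖y j‖ := by
  have hyi (i : ι) : ∑ k, y k i = 0 := by simpa using congr(($hy).ofLp i)
  choose s hanti hs using fun i => exists_antisymm_sum_eq (hyi i)
  refine ⟨fun j k => WithLp.toLp 1 fun i => s i j k, fun j k => ?_, fun j => ⟨?_, ?_⟩⟩
  · ext i
    simp [hanti i j k]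
  · ext i
    simp [(hs i j).1]
  · simp only [PiLp.norm_eq_of_L1, Real.norm_eq_abs]
    rw [Finset.sum_comm]
    exact Finset.sum_congr rfl fun i _ => (hs i j).2

end Transport

section HalfSumDiff

variable {ι Y : Type*} [NormedAddCommGroup Y] [NormedSpace ℝ Y]

/-- The operator `x ↦ (x_a + x_b) / 2 • u + (x_a - x_b) / 2 • w` on `ℓ_∞`, the common form of all
extreme contractions from `ℓ_∞³` to `ℓ_1ⁿ`. -/
noncomputable def halfSumDiff (a b : ι) (u w : Y) : (PiLp ∞ fun _ : ι => ℝ) →L[ℝ] Y :=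
  ((1 / 2 : ℝ) • (PiLp.proj (𝕜 := ℝ) ∞ (fun _ => ℝ) a + PiLp.proj ∞ (fun _ => ℝ) b)).smulRight u +
    ((1 / 2 : ℝ) • (PiLp.proj (𝕜 := ℝ) ∞ (fun _ => ℝ) a - PiLp.proj ∞ (fun _ => ℝ) b)).smulRight w

theorem halfSumDiff_apply (a b : ι) (u w : Y) (x : PiLp ∞ fun _ : ι => ℝ) :
    halfSumDiff a b u w x = ((x a + x b) / 2) • u + ((x a - x b) / 2) • w := by
  simp [halfSumDiff, div_eq_inv_mul, mul_add, mul_sub]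

theorem halfSumDiff_add (a b : ι) (u w u' w' : Y) :
    halfSumDiff a b (u + u') (w + w') = halfSumDiff a b u w + halfSumDiff a b u' w' := by
  ext x
  simp only [halfSumDiff_apply, add_apply]
  module

theorem halfSumDiff_sub (a b : ι) (u w u' w' : Y) :
    halfSumDiff a b (u - u') (w - w') = halfSumDiff a b u w - halfSumDiff a b u' w' := by
  ext x
  simp only [halfSumDiff_apply, sub_apply]
  module

theorem halfSumDiff_smul (a b : ι) (c : ℝ) (u w : Y) :
    halfSumDiff a b (c • u) (c • w) = c • halfSumDiff a b u w := by
  ext x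
  simp only [halfSumDiff_apply, smul_apply]
  module

theorem halfSumDiff_eq_zero_iff {a b : ι} (hab : a ≠ b) {u w : Y} :
    halfSumDiff a b u w = 0 ↔ u = 0 ∧ w = 0 := by
  classical
  refine ⟨fun h => ?_, ?_⟩
  · have hu : u = 0 := by
      simpa [halfSumDiff_apply] using congr($h (WithLp.toLp ∞ fun _ => 1))
    refine ⟨hu, ?_⟩
    simpa [halfSumDiff_apply, hu, hab.symm] using congr($h (PiLp.single ∞ a 2))
  · rintro ⟨rfl, rfl⟩
    ext x
    simp [halfSumDiff_apply]

variable [Fintype ι]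

theorem norm_halfSumDiff_le (a b : ι) {u w : Y} {r : ℝ} (hu : ‖u‖ ≤ r) (hw : ‖w‖ ≤ r) :
    ‖halfSumDiff a b u w‖ ≤ r := by
  have hr : 0 ≤ r := (norm_nonneg _).trans hu
  refine ContinuousLinearMap.opNorm_le_bound _ hr fun x => ?_
  have hx : |x a + x b| / 2 + |x a - x b| / 2 ≤ ‖x‖ := by
    obtain ⟨ha, ha'⟩ := abs_le.1 (PiLp.norm_apply_le x a)
    obtain ⟨hb, hb'⟩ := abs_le.1 (PiLp.norm_apply_le x b)
    rcases abs_cases (x a + x b) with h | h <;> rcases abs_cases (x a - x b) with h' | h' <;>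
      linarith
  calc ‖halfSumDiff a b u w x‖
      ≤ ‖((x a + x b) / 2) • u‖ + ‖((x a - x b) / 2) • w‖ := by
        rw [halfSumDiff_apply]; exact norm_add_le _ _
    _ = |x a + x b| / 2 * ‖u‖ + |x a - x b| / 2 * ‖w‖ := by simp [norm_smul]
    _ ≤ |x a + x b| / 2 * r + |x a - x b| / 2 * r := by gcongr
    _ = r * (|x a + x b| / 2 + |x a - x b| / 2) := by ring
    _ ≤ r * ‖x‖ := by gcongr

theorem mem_extremePoints_of_isExtremeContraction_halfSumDiff {a b : ι} (hab : a ≠ b) {u w : Y}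
    (hu : ‖u‖ ≤ 1) (hw : ‖w‖ ≤ 1) (h : IsExtremeContraction (halfSumDiff a b u w)) :
    u ∈ (Metric.closedBall (0 : Y) 1).extremePoints ℝ ∧
      w ∈ (Metric.closedBall (0 : Y) 1).extremePoints ℝ := by
  have hzero {d e : Y} (hd : ‖u + d‖ ≤ 1) (hd' : ‖u - d‖ ≤ 1) (he : ‖w + e‖ ≤ 1)
      (he' : ‖w - e‖ ≤ 1) : d = 0 ∧ e = 0 := by
    rw [← halfSumDiff_eq_zero_iff hab]
    refine (mem_extremePoints_closedBall_iff.1 h).2 _ ?_ ?_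
    · rw [← halfSumDiff_add]
      exact norm_halfSumDiff_le a b hd he
    · rw [← halfSumDiff_sub]
      exact norm_halfSumDiff_le a b hd' he'
  exact ⟨mem_extremePoints_closedBall_iff.2 ⟨hu, fun d hd hd' =>
      (hzero hd hd' (e := 0) (by simpa) (by simpa)).1⟩,
    mem_extremePoints_closedBall_iff.2 ⟨hw, fun e he he' =>
      (hzero (d := 0) (by simpa) (by simpa) he he').2⟩⟩

end HalfSumDiff

section ExtremeContraction

variable {ι : Type*} [Fintype ι]

theorem exists_eq_sum_halfSumDiff {T : ell ∞ 3 →L[ℝ] PiLp 1 fun _ : ι => ℝ}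
    (hT : ∀ j, ‖T (cubeVertex j)‖ = 1) :
    ∃ u w : Fin 3 → PiLp 1 fun _ : ι => ℝ, (∀ k, ‖w k‖ = ‖u k‖) ∧ ∑ k, ‖u k‖ = 1 ∧
      ∑ k, halfSumDiff (k + 1) (k + 2) (u k) (w k) = T := by
  obtain ⟨s, hanti, hs⟩ := exists_antisymm_sum_eq_piLp (y := fun j => T (cubeVertex j))
    (by rw [← map_sum, sum_cubeVertex, map_zero])
  have : IsAddTorsionFree (PiLp 1 fun _ : ι => ℝ) := .of_module_rat _
  have hdiag (j : Fin 4) : s j j = 0 := self_eq_neg.1 (hanti j j)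
  have hsymm (j k : Fin 4) : ‖s k j‖ = ‖s j k‖ := by rw [hanti, norm_neg]
  have hweight (j : Fin 4) : ‖s j 0‖ + ‖s j 1‖ + ‖s j 2‖ + ‖s j 3‖ = 1 := by
    rw [← Fin.sum_univ_four fun k => ‖s j k‖, (hs j).2, hT]
  have h0 := hweight 0
  have h1 := hweight 1
  have h2 := hweight 2
  have h3 := hweight 3
  rw [hdiag, norm_zero] at h0 h1 h2 h3
  rw [hsymm 0 1] at h1
  rw [hsymm 0 2, hsymm 1 2] at h2
  rw [hsymm 0 3, hsymm 1 3, hsymm 2 3] at h3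
  refine ⟨![s 0 1, s 0 2, s 0 3], ![s 2 3, s 3 1, s 1 2], fun k => ?_, ?_, ?_⟩
  · fin_cases k <;>
      simp only [Fin.zero_eta, Fin.mk_one, Fin.reduceFinMk, Matrix.cons_val, hsymm 1 3] <;>
      linarith
  · simp only [Fin.sum_univ_three, Matrix.cons_val]
    linarith
  · refine ext_cubeVertex fun j => ?_
    rw [← (hs j).1]
    fin_cases j <;>
      simp [Fin.sum_univ_three, Fin.sum_univ_four, halfSumDiff_apply, cubeVertex, hdiag,
        hanti 0 1, hanti 0 2, hanti 0 3, hanti 1 2, hanti 1 3, hanti 2 3] <;>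
      module

theorem exists_eq_halfSumDiff_of_isExtremeContraction [Nonempty ι]
    {T : ell ∞ 3 →L[ℝ] PiLp 1 fun _ : ι => ℝ} (hT : IsExtremeContraction T) :
    ∃ (a b : Fin 3) (u w : PiLp 1 fun _ : ι => ℝ), a ≠ b ∧ ‖u‖ = 1 ∧ ‖w‖ = 1 ∧
      T = halfSumDiff a b u w := by
  obtain ⟨u, w, hwu, hu, hsum⟩ := exists_eq_sum_halfSumDiff (norm_apply_cubeVertex_eq_one hT)
  obtain ⟨k, hk⟩ : ∃ k, ‖u k‖ ≠ 0 := by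
    by_contra! h
    simp [h] at hu
  have hkT : halfSumDiff (k + 1) (k + 2) (u k) (w k) = ‖u k‖ • T :=
    eq_smul_of_sum_eq_of_mem_extremePoints hT
      (fun i _ => norm_halfSumDiff_le (i + 1) (i + 2) le_rfl (hwu i).le) hu.le hsum
      (Finset.mem_univ k)
  refine ⟨k + 1, k + 2, ‖u k‖⁻¹ • u k, ‖u k‖⁻¹ • w k, by simp, ?_, ?_, ?_⟩
  · rw [norm_smul, norm_inv, norm_norm, inv_mul_cancel₀ hk]
  · rw [norm_smul, norm_inv, norm_norm, hwu, inv_mul_cancel₀ hk]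
  · rw [halfSumDiff_smul, hkT, inv_smul_smul₀ hk]

theorem exists_coord_eq_zero_of_isExtremeContraction {n : ℕ} (hn : 3 ≤ n)
    {T : ell ∞ 3 →L[ℝ] ell 1 n} (hT : IsExtremeContraction T) : ∃ l, ∀ x, T x l = 0 := by
  have : NeZero n := ⟨by lia⟩
  obtain ⟨a, b, u, w, hab, hu, hw, rfl⟩ := exists_eq_halfSumDiff_of_isExtremeContraction hT
  obtain ⟨hue, hwe⟩ :=
    mem_extremePoints_of_isExtremeContraction_halfSumDiff hab hu.le hw.le hT
  obtain ⟨i, c, -, rfl⟩ := exists_eq_single_of_mem_extremePoints hue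
  obtain ⟨k, e, -, rfl⟩ := exists_eq_single_of_mem_extremePoints hwe
  obtain ⟨l, hli, hlk⟩ := Fin.exists_ne_and_ne_of_two_lt i k hn
  exact ⟨l, fun x => by simp [halfSumDiff_apply, hli, hlk]⟩

end ExtremeContraction

end UniformBPB

open UniformBPB in
theorem mainTheorem9_general {n : ℕ} (hn : 3 ≤ n) {T : ell ∞ 3 →L[ℝ] ell 1 n} (hT : ‖T‖ = 1)
    {ε : ℝ} (hε : 0 < ε) :
    ∃ A : ell ∞ 3 →L[ℝ] ell 1 n, IsNontrivialUniformBPBApprox ε T A ∧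
      normAttainmentSet T = normAttainmentSet A := by
  by_cases hext : IsExtremeContraction T
  · obtain ⟨k, hk⟩ := exists_coord_eq_zero_of_isExtremeContraction hn hext
    exact exists_nontrivial_approx_of_coord_eq_zero hT hk hε
  · exact exists_nontrivial_approx_of_not_isExtremeContraction hT hext hε

theorem mainTheorem9 :
    (∀ T : UniformBPB.ell ∞ 3 →L[ℝ] UniformBPB.ell 1 3, UniformBPB.IsExtremeContraction T →
      ∀ ε : ℝ, 0 < ε → ∃ A : UniformBPB.ell ∞ 3 →L[ℝ] UniformBPB.ell 1 3,
        UniformBPB.IsNontrivialUniformBPBApprox ε T A ∧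
          UniformBPB.normAttainmentSet T = UniformBPB.normAttainmentSet A) ∧
    UniformBPB.HasNontrivialNormPreservingUniformBPB
      (UniformBPB.ell ∞ 3) (UniformBPB.ell 1 3) :=
  ⟨fun _ hT _ hε => mainTheorem9_general le_rfl
    (by simpa using extremePoints_closedBall_subset_sphere hT) hε,
    fun _ hT _ _ hε => mainTheorem9_general le_rfl hT hε⟩
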